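/- Let $(X,Y)$ be a random pair with law $p$ on $\mathbb R^d\times\{-1,+1\}$, with known label marginals $p(Y=1)\neq p(Y=-1)$. For $\theta,x\in\mathbb R^d$ put $f_\theta(x)=\sum_{j=1}^d\theta_jx_j$. Let $L(y,\alpha)$ be one of the losses $e^{-y\alpha}$, $\log(1+e^{-y\alpha})$, $(1-y\alpha)_+$, and let $R(\theta)=\mathbb E_p\,L(Y,f_\theta(X))$. Let $E\subset\mathbb R^2\times(0,\infty)^2$ be a compact set of parameters $\eta=(\mu_1,\mu_{-1},\sigma_1,\sigma_{-1})$, and let $\Theta\subset\mathbb R^d$ be a bounded set such that for every $\theta\in\Theta$ there is $\eta\in E$ with $$f_\theta(X)\mid\{Y=y\}\ \sim\ N(\mu_y,\sigma_y^2),\qquad y\in\{-1,+1\}$$ (in particular, if $\Theta\ne\emptyset$, both labels have positive probability). Write $N(\cdot\,;\mu,\sigma^2)$ for the normal density. Let $X^{(1)},X^{(2)},\dots$ be i.i.d. copies of $X$ (unlabeled data). For $n\ge 0$ and $\theta\in\Theta$ let $\hat\eta_n(\theta)=(\hat\mu^{(n)},\hat\sigma^{(n)})$ be a maximum likelihood estimate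 over $E$, that is, any maximizer over $\eta\in E$ of $$\ell_n(\eta)=\sum_{i=1}^n\log\sum_{y\in\{-1,+1\}}p(Y=y)\,N\big(f_\theta(X^{(i)});\mu_y,\sigma_y^2\big),$$ and let the plug-in risk estimate be $$\hat R_n(\theta)=\sum_{y\in\{-1,+1\}}p(Y=y)\int_{\mathbb R}N\big(\alpha;\hat\mu^{(n)}_y,(\hat\sigma^{(n)}_y)^2\big)\,L(y,\alpha)\,d\alpha .$$ Then the expectations and integrals that define $R(\theta)$ and $\hat R_n(\theta)$ are finite, and, with probability $1$, $\hat R_n(\theta)\to R(\theta)$ as $n\to\infty$ uniformly in $\theta\in\Theta$. -/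

import Mathlib

open MeasureTheory ProbabilityTheory Filter

noncomputable section

/-- The parameter `η = (μ, σ)` of a two-component Gaussian mixture: `η.1 y` is the mean and
`η.2 y` the standard deviation of the component with label `y`. The labels `y ∈ {-1, +1}` are the
units of `ℤ`. -/
abbrev MixtureParam : Type := (ℤˣ → ℝ) × (ℤˣ → ℝ)

/-- The margin function `f_θ(x) = ∑ j, θ_j x_j`. -/
def marginFun {d : ℕ} (θ x : Fin d → ℝ) : ℝ := ∑ j, θ j * x j

/-- The exponential loss `L(y, α) = exp (-y α)`. -/
def expLoss (y : ℤˣ) (α : ℝ) : ℝ := Real.exp (-(((y : ℤ) : ℝ) * α))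

/-- The logloss `L(y, α) = log (1 + exp (-y α))`. -/
def logLoss (y : ℤˣ) (α : ℝ) : ℝ := Real.log (1 + Real.exp (-(((y : ℤ) : ℝ) * α)))

/-- The hinge loss `L(y, α) = (1 - y α)₊`. -/
def hingeLoss (y : ℤˣ) (α : ℝ) : ℝ := max (1 - ((y : ℤ) : ℝ) * α) 0

/-- The label marginal `p(Y = y)` of the joint law `p` of `(X, Y)`. -/
def labelMarginal {d : ℕ} (p : Measure ((Fin d → ℝ) × ℤˣ)) (y : ℤˣ) : ℝ :=
  p.real (Prod.snd ⁻¹' {y})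

/-- The risk `R(θ) = E L(Y, f_θ(X))` for `(X, Y)` with law `p`. -/
def risk {d : ℕ} (p : Measure ((Fin d → ℝ) × ℤˣ)) (L : ℤˣ → ℝ → ℝ) (θ : Fin d → ℝ) : ℝ :=
  ∫ z, L z.2 (marginFun θ z.1) ∂p

/-- Under `p`, the conditional law of `f_θ(X)` given `Y = y` is `N(μ_y, σ_y²)`, for each label
`y`, where `η = (μ, σ)`. -/
def IsTrueParam {d : ℕ} (p : Measure ((Fin d → ℝ) × ℤˣ)) (θ : Fin d → ℝ)
    (η : MixtureParam) : Prop :=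
  ∀ y : ℤˣ, (ProbabilityTheory.cond p (Prod.snd ⁻¹' {y})).map (fun z => marginFun θ z.1)
    = gaussianReal (η.1 y) (Real.toNNReal (η.2 y ^ 2))

/-- The density at `z` of the mixture `∑ y, w y • N(μ_y, σ_y²)`. -/
def mixtureDensity (w : ℤˣ → ℝ) (η : MixtureParam) (z : ℝ) : ℝ :=
  ∑ y : ℤˣ, w y * gaussianPDFReal (η.1 y) (Real.toNNReal (η.2 y ^ 2)) z

/-- The log-likelihood of `η` for the first `n` terms of the sequence `z`. -/
def logLikelihood (w : ℤˣ → ℝ) (n : ℕ) (z : ℕ → ℝ) (η : MixtureParam) : ℝ :=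
  ∑ i ∈ Finset.range n, Real.log (mixtureDensity w η (z i))

/-- `η` is a maximum likelihood estimate over the parameter set `E`, for the first `n` terms
of `z`. -/
def IsMLE (w : ℤˣ → ℝ) (E : Set MixtureParam) (n : ℕ) (z : ℕ → ℝ) (η : MixtureParam) : Prop :=
  η ∈ E ∧ IsMaxOn (logLikelihood w n z) E η

/-- The plug-in risk `∑ y, w y ∫ N(α; μ_y, σ_y²) L(y, α) dα`. -/
def plugInRisk (w : ℤˣ → ℝ) (L : ℤˣ → ℝ → ℝ) (η : MixtureParam) : ℝ :=
  ∑ y : ℤˣ, w y * ∫ α, gaussianPDFReal (η.1 y) (Real.toNNReal (η.2 y ^ 2)) α * L y α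

end

/-! ### Linear independence of Gaussian densities and identifiability of mixtures -/

/-! Write `ll (η, θ)` for the expected log-density of the mixture `η` at `f_θ(X)`. If `ξ` is a true
parameter for `θ`, then `f_θ(X)` has mixture density `ξ`, so `ll (·, θ)` is maximal at `ξ` by Gibbs'
inequality. The maximizer is unique because unequal weights make the mixture identifiable, labels
included (`expected_log_mixtureDensity_lt`, `mixtureDensity_injective`).

The average log-likelihood converges to `ll` uniformly on the compact set `E × closure Θ`, by the
strong law in the Banach space of continuous functions (`uniform_strong_law`). Its integrable
envelope comes from quadratic growth of the log-densities and `exists_integrable_sq_envelope`. Hence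
the estimate nearly maximizes `ll (·, θ)`, uniformly in `θ`.

A compactness argument (`exists_uniform_gap`) turns this into closeness of the plug-in risks at the
estimate and at `ξ`, and the latter is the true risk. It uses that being a true parameter is a
closed relation between `η` and `θ` (`isClosed_isTrueParam`). -/

theorem gaussianPDFReal_sq (m s z : ℝ) :
    gaussianPDFReal m (Real.toNNReal (s ^ 2)) z
      = (√(2 * Real.pi * s ^ 2))⁻¹ * Real.exp (-(z - m) ^ 2 / (2 * s ^ 2)) := by
  rw [gaussianPDFReal, Real.coe_toNNReal _ (sq_nonneg s)]

theorem toNNReal_sq_ne_zero {s : ℝ} (hs : 0 < s) : Real.toNNReal (s ^ 2) ≠ 0 :=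
  (Real.toNNReal_pos.2 (by positivity)).ne'

theorem tendsto_quadratic_atBot {a b : ℝ} (h : a < 0 ∨ a = 0 ∧ b < 0) (c : ℝ) :
    Tendsto (fun z : ℝ => a * z ^ 2 + b * z + c) atTop atBot := by
  have key : Tendsto (fun z : ℝ => z * (a * z + b)) atTop atBot := by
    rcases h with ha | ⟨rfl, hb⟩
    · exact tendsto_id.atTop_mul_atBot₀
        (tendsto_atBot_add_const_right _ _ (tendsto_id.const_mul_atTop_of_neg ha))
    · simpa using tendsto_id.atTop_mul_const_of_neg hb
  refine (tendsto_atBot_add_const_right _ c key).congr fun z => ?_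
  ring

/-- The density with the lexicographically smaller `(σ, μ)` is negligible at `+∞`. -/
theorem tendsto_gaussianPDFReal_div {m s m' s' : ℝ} (hs : 0 < s) (hs' : 0 < s')
    (h : s' < s ∨ s' = s ∧ m' < m) :
    Tendsto (fun z => gaussianPDFReal m' (Real.toNNReal (s' ^ 2)) z /
      gaussianPDFReal m (Real.toNNReal (s ^ 2)) z) atTop (nhds 0) := by
  have hlim := tendsto_quadratic_atBot (a := 1 / (2 * s ^ 2) - 1 / (2 * s' ^ 2))
    (b := m' / s' ^ 2 - m / s ^ 2) (by
      rcases h with h | ⟨rfl, h⟩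
      · left
        have : 1 / (2 * s ^ 2) < 1 / (2 * s' ^ 2) := by gcongr
        linarith
      · right
        refine ⟨sub_self _, sub_neg.2 ?_⟩
        gcongr) (m ^ 2 / (2 * s ^ 2) - m' ^ 2 / (2 * s' ^ 2))
  have := (Real.tendsto_exp_atBot.comp hlim).const_mul
    ((√(2 * Real.pi * s' ^ 2))⁻¹ / (√(2 * Real.pi * s ^ 2))⁻¹)
  rw [mul_zero] at this
  refine this.congr fun z => ?_
  rw [gaussianPDFReal_sq, gaussianPDFReal_sq, mul_div_mul_comm, ← Real.exp_sub,
    Function.comp_apply]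
  congr 2
  field_simp
  ring

/-- Gaussian densities with pairwise distinct parameters `(σ, μ)` are linearly independent. -/
theorem gaussianPDFReal_linearIndependent (S : Finset (ℝ ×ₗ ℝ))
    (hS : ∀ k ∈ S, 0 < (ofLex k).1) (c : ℝ ×ₗ ℝ → ℝ)
    (h : ∀ z, ∑ k ∈ S, c k *
      gaussianPDFReal (ofLex k).2 (Real.toNNReal ((ofLex k).1 ^ 2)) z = 0) :
    ∀ k ∈ S, c k = 0 := by
  by_contra! hne
  obtain ⟨k₀, hk₀, hck₀⟩ := hne
  -- Divide the relation by the density of the largest index with nonzero coefficient and let `z →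
  -- ∞`: only that coefficient survives, so it is zero.
  set T := S.filter (fun k => c k ≠ 0) with hT
  have hTne : T.Nonempty := ⟨k₀, by simp [hT, hk₀, hck₀]⟩
  set q := T.max' hTne
  have hqT : q ∈ T := T.max'_mem hTne
  have hpos : ∀ k ∈ T, 0 < (ofLex k).1 := fun k hk => hS k (Finset.mem_filter.1 hk).1
  have hlim : Tendsto (fun z => ∑ k ∈ T, c k *
      (gaussianPDFReal (ofLex k).2 (Real.toNNReal ((ofLex k).1 ^ 2)) z /
        gaussianPDFReal (ofLex q).2 (Real.toNNReal ((ofLex q).1 ^ 2)) z)) atTop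
      (nhds (∑ k ∈ T, c k * if k = q then 1 else 0)) := by
    refine tendsto_finsetSum _ fun k hk => Tendsto.const_mul _ ?_
    split_ifs with hkq
    · subst hkq
      refine tendsto_const_nhds.congr fun z => (div_self ?_).symm
      exact (gaussianPDFReal_pos _ _ _ (toNNReal_sq_ne_zero (hpos _ hqT))).ne'
    · refine tendsto_gaussianPDFReal_div (hpos _ hqT) (hpos _ hk) ?_
      exact Prod.Lex.lt_iff.1 (lt_of_le_of_ne (T.le_max' k hk) hkq)
  have hzero : ∀ z, ∑ k ∈ T, c k *
      (gaussianPDFReal (ofLex k).2 (Real.toNNReal ((ofLex k).1 ^ 2)) z /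
        gaussianPDFReal (ofLex q).2 (Real.toNNReal ((ofLex q).1 ^ 2)) z) = 0 := by
    intro z
    simp_rw [← mul_div_assoc, ← Finset.sum_div]
    rw [hT, Finset.sum_filter_of_ne, h z, zero_div]
    intro k _ hk hc
    exact hk (by rw [hc, zero_mul])
  simp_rw [hzero] at hlim
  have hcq := tendsto_nhds_unique hlim tendsto_const_nhds
  simp only [mul_ite, mul_one, mul_zero, Finset.sum_ite_eq', hqT, if_true] at hcq
  exact (Finset.mem_filter.1 hqT).2 hcq

/-- Two-component Gaussian mixtures with known, unequal, positive weights are identifiable. -/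
theorem mixtureDensity_injective {w : ℤˣ → ℝ} (hw : ∀ y, 0 < w y) (hne : w 1 ≠ w (-1))
    {η ξ : MixtureParam} (hη : ∀ y, 0 < η.2 y) (hξ : ∀ y, 0 < ξ.2 y)
    (h : ∀ z, mixtureDensity w η z = mixtureDensity w ξ z) : η = ξ := by
  set k : MixtureParam → ℤˣ → ℝ ×ₗ ℝ := fun ζ y => toLex (ζ.2 y, ζ.1 y) with hk
  set S : Finset (ℝ ×ₗ ℝ) := Finset.univ.image (k η) ∪ Finset.univ.image (k ξ) with hS
  -- `cc ζ q` is the total weight that `ζ` places at `q`; components of `ζ` that coincide are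
  -- merged.
  set cc : MixtureParam → ℝ ×ₗ ℝ → ℝ := fun ζ q => ∑ y, w y * if k ζ y = q then 1 else 0 with hcc
  have hmemη : ∀ y, k η y ∈ S := fun y =>
    Finset.mem_union_left _ (Finset.mem_image_of_mem _ (Finset.mem_univ y))
  have hmemξ : ∀ y, k ξ y ∈ S := fun y =>
    Finset.mem_union_right _ (Finset.mem_image_of_mem _ (Finset.mem_univ y))
  have expand : ∀ ζ : MixtureParam, (∀ y, k ζ y ∈ S) → ∀ z,
      ∑ q ∈ S, cc ζ q * gaussianPDFReal (ofLex q).2 (Real.toNNReal ((ofLex q).1 ^ 2)) z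
        = mixtureDensity w ζ z := by
    intro ζ hζ z
    simp_rw [hcc, Finset.sum_mul]
    rw [Finset.sum_comm, mixtureDensity]
    refine Finset.sum_congr rfl fun y _ => ?_
    rw [Finset.sum_eq_single (k ζ y)]
    · simp [hk]
    · intro q _ hq
      simp [hq.symm]
    · exact fun hn => absurd (hζ y) hn
  have hzero := gaussianPDFReal_linearIndependent S (by
      intro q hq
      simp only [hS, Finset.mem_union, Finset.mem_image, Finset.mem_univ, true_and] at hq
      rcases hq with ⟨y, rfl⟩ | ⟨y, rfl⟩
      · exact hη y
      · exact hξ y) (fun q => cc η q - cc ξ q) (fun z => by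
      simp_rw [sub_mul, Finset.sum_sub_distrib]
      rw [expand η hmemη, expand ξ hmemξ, h z, sub_self])
  have e1 := hzero _ (hmemη 1)
  have e2 := hzero _ (hmemη (-1))
  have p1 := hw 1
  have p2 := hw (-1)
  have u1 : (Finset.univ : Finset ℤˣ) = {1, -1} := rfl
  have hne' : (1 : ℤˣ) ≠ -1 := by decide
  simp only [hcc, u1, Finset.sum_pair hne'] at e1 e2
  -- Otherwise `ξ` has weight `0` or `w (-1)` at `k η 1`, where `η` has `w 1` or `w 1 + w (-1)`.
  -- Positivity and inequality of the weights exclude every match.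
  have hk1 : k ξ 1 = k η 1 := by
    by_contra hc
    simp only [if_neg hc, if_true] at e1
    split_ifs at e1 <;> exact hne (by linarith)
  have hk2 : k ξ (-1) = k η (-1) := by
    by_contra hc
    simp only [if_neg hc, if_true] at e2
    split_ifs at e2 <;> exact hne (by linarith)
  have hall : ∀ y, k ξ y = k η y := fun y => by
    rcases Int.units_eq_one_or y with rfl | rfl <;> assumption
  have hall' : ∀ y, ξ.2 y = η.2 y ∧ ξ.1 y = η.1 y := fun y => by
    simpa [hk] using hall y
  exact Prod.ext (funext fun y => (hall' y).2.symm) (funext fun y => (hall' y).1.symm)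

/-! ### The joint law as a mixture of its conditional laws -/

instance : MeasurableSingletonClass ℤˣ where
  measurableSet_singleton y := by
    have h : (Units.val ⁻¹' {(y : ℤ)} : Set ℤˣ) = {y} := by
      ext u
      simp [Units.val_inj]
    rw [← h]
    exact ⟨{(y : ℤ)}, measurableSet_singleton _, rfl⟩

theorem continuous_marginFun {d : ℕ} :
    Continuous fun q : (Fin d → ℝ) × (Fin d → ℝ) => marginFun q.1 q.2 := by
  unfold marginFun
  fun_prop

theorem measurable_marginFun {d : ℕ} (θ : Fin d → ℝ) : Measurable (marginFun θ) :=
  (continuous_marginFun.comp (Continuous.prodMk_right θ)).measurable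

theorem marginFun_add {d : ℕ} (θ τ x : Fin d → ℝ) :
    marginFun (θ + τ) x = marginFun θ x + marginFun τ x := by
  simp [marginFun, add_mul, Finset.sum_add_distrib]

theorem marginFun_smul {d : ℕ} (c : ℝ) (θ x : Fin d → ℝ) :
    marginFun (c • θ) x = c * marginFun θ x := by
  simp [marginFun, mul_assoc, Finset.mul_sum]

section JointLaw

variable {d : ℕ} {p : Measure ((Fin d → ℝ) × ℤˣ)} [IsProbabilityMeasure p]
  {θ : Fin d → ℝ} {η : MixtureParam}

theorem measurableSet_label (y : ℤˣ) :
    MeasurableSet (Prod.snd ⁻¹' {y} : Set ((Fin d → ℝ) × ℤˣ)) :=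
  measurable_snd (measurableSet_singleton y)

/-- Conditioning on a null event gives the zero measure, which is not Gaussian. -/
theorem labelMarginal_pos (h : IsTrueParam p θ η) (y : ℤˣ) : 0 < labelMarginal p y := by
  refine ENNReal.toReal_pos (fun h0 => ?_) (measure_ne_top _ _)
  have h1 := h y
  rw [cond_eq_zero_of_meas_eq_zero h0, Measure.map_zero] at h1
  exact IsProbabilityMeasure.ne_zero _ h1.symm

/-- `p` is the sum of its conditional laws given the label, weighted by the marginals, and `F y`
sees only the margin. This serves the risk, the second moments and the expected log-likelihood. -/
theorem integral_label_margin (h : IsTrueParam p θ η) {F : ℤˣ → ℝ → ℝ}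
    (hF : ∀ y, Integrable (F y) (gaussianReal (η.1 y) (Real.toNNReal (η.2 y ^ 2)))) :
    Integrable (fun z => F z.2 (marginFun θ z.1)) p ∧
      ∫ z, F z.2 (marginFun θ z.1) ∂p
        = ∑ y, labelMarginal p y *
          ∫ a, F y a ∂gaussianReal (η.1 y) (Real.toNNReal (η.2 y ^ 2)) := by
  have hm : Measurable fun z : (Fin d → ℝ) × ℤˣ => marginFun θ z.1 :=
    (measurable_marginFun θ).comp measurable_fst
  have hp := sum_meas_smul_cond_fiber (μ := p) (X := Prod.snd) measurable_snd
  have hae : ∀ y : ℤˣ, (fun z => F z.2 (marginFun θ z.1))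
      =ᵐ[ProbabilityTheory.cond p (Prod.snd ⁻¹' {y})] fun z => F y (marginFun θ z.1) := by
    intro y
    filter_upwards [ae_cond_mem (measurableSet_label y)] with z hz
    rw [show z.2 = y from hz]
  have hint : ∀ y : ℤˣ, Integrable (fun z => F z.2 (marginFun θ z.1))
      (ProbabilityTheory.cond p (Prod.snd ⁻¹' {y})) := by
    intro y
    rw [integrable_congr (hae y)]
    exact (h y ▸ hF y).comp_measurable hm
  have hint' : ∀ y ∈ Finset.univ, Integrable (fun z => F z.2 (marginFun θ z.1))
      (p (Prod.snd ⁻¹' {y}) • ProbabilityTheory.cond p (Prod.snd ⁻¹' {y})) :=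
    fun y _ => (hint y).smul_measure (measure_ne_top _ _)
  constructor
  · rw [← hp]
    exact integrable_finsetSum_measure.2 hint'
  · conv_lhs => rw [← hp]
    rw [integral_finsetSum_measure hint']
    refine Finset.sum_congr rfl fun y _ => ?_
    rw [integral_smul_measure, integral_congr_ae (hae y), ← h y,
      integral_map hm.aemeasurable (h y ▸ (hF y).aestronglyMeasurable), smul_eq_mul]
    rfl

end JointLaw

/-! ### Integrals against Gaussian measures -/

theorem integral_gaussianReal_eq_integral_mul {m s : ℝ} (hs : 0 < s) (f : ℝ → ℝ) :
    ∫ a, f a ∂gaussianReal m (Real.toNNReal (s ^ 2))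
      = ∫ a, gaussianPDFReal m (Real.toNNReal (s ^ 2)) a * f a :=
  integral_gaussianReal_eq_integral_smul (toNNReal_sq_ne_zero hs)

theorem integrable_gaussianReal_iff {m s : ℝ} (hs : 0 < s) (f : ℝ → ℝ) :
    Integrable f (gaussianReal m (Real.toNNReal (s ^ 2)))
      ↔ Integrable fun a => gaussianPDFReal m (Real.toNNReal (s ^ 2)) a * f a := by
  rw [gaussianReal_of_var_ne_zero _ (toNNReal_sq_ne_zero hs),
    integrable_withDensity_iff_integrable_smul' (measurable_gaussianPDF _ _)
      (ae_of_all _ fun _ => gaussianPDF_lt_top)]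
  simp [toReal_gaussianPDF]

/-- Moves the parameters from the measure into the integrand, so that continuity in them follows by
dominated convergence against `N(0, 1)`. -/
theorem gaussianReal_eq_map_affine (m s : ℝ) :
    gaussianReal m (Real.toNNReal (s ^ 2)) = (gaussianReal 0 1).map (fun u => m + s * u) := by
  have h : (fun u : ℝ => m + s * u) = (fun u => u + m) ∘ fun u => s * u := by
    ext u
    simp [add_comm]
  rw [h, ← Measure.map_map (by fun_prop) (by fun_prop), gaussianReal_map_const_mul,
    gaussianReal_map_add_const]
  congr 1
  · simp
  · ext
    simp [Real.coe_toNNReal _ (sq_nonneg s)]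

theorem integrable_sq_gaussianReal (m : ℝ) (v : NNReal) :
    Integrable (fun a : ℝ => a ^ 2) (gaussianReal m v) := by
  have h := (memLp_id_gaussianReal (μ := m) (v := v) 2).integrable_sq
  simpa using h

theorem integrable_exp_abs_gaussianReal (t m : ℝ) (v : NNReal) :
    Integrable (fun a : ℝ => Real.exp (t * |a|)) (gaussianReal m v) :=
  integrable_exp_mul_abs (X := fun a => a) (integrable_exp_mul_gaussianReal t)
    (integrable_exp_mul_gaussianReal (-t))

/-! ### The losses and the plug-in risk -/

theorem abs_units_int_mul (y : ℤˣ) (a : ℝ) : |((y : ℤ) : ℝ) * a| = |a| := by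
  rcases Int.units_eq_one_or y with rfl | rfl <;> simp

theorem margin_loss_continuous {L : ℤˣ → ℝ → ℝ}
    (hL : L = expLoss ∨ L = logLoss ∨ L = hingeLoss) (y : ℤˣ) : Continuous (L y) := by
  rcases hL with rfl | rfl | rfl
  · unfold expLoss
    fun_prop
  · unfold logLoss
    refine Continuous.log (by fun_prop) fun a => ?_
    positivity
  · unfold hingeLoss
    fun_prop

theorem margin_loss_abs_le {L : ℤˣ → ℝ → ℝ}
    (hL : L = expLoss ∨ L = logLoss ∨ L = hingeLoss) (y : ℤˣ) (a : ℝ) :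
    |L y a| ≤ Real.exp |a| := by
  have h1 : -(((y : ℤ) : ℝ) * a) ≤ |a| := (neg_le_abs _).trans_eq (abs_units_int_mul y a)
  have h2 : Real.exp (-(((y : ℤ) : ℝ) * a)) ≤ Real.exp |a| := Real.exp_le_exp.2 h1
  have h3 := Real.add_one_le_exp |a|
  rcases hL with rfl | rfl | rfl
  · rwa [expLoss, abs_of_pos (Real.exp_pos _)]
  · have h4 := Real.exp_pos (-(((y : ℤ) : ℝ) * a))
    rw [logLoss, abs_of_nonneg (Real.log_nonneg (by linarith))]
    have := Real.log_le_sub_one_of_pos (x := 1 + Real.exp (-(((y : ℤ) : ℝ) * a))) (by linarith)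
    linarith
  · rw [hingeLoss, abs_of_nonneg (le_max_right _ _)]
    exact max_le (by linarith) (Real.exp_pos _).le

theorem integrable_of_abs_le_exp {f : ℝ → ℝ} (hc : Continuous f)
    (hb : ∀ a, |f a| ≤ Real.exp |a|) (m : ℝ) (v : NNReal) : Integrable f (gaussianReal m v) :=
  (by simpa using integrable_exp_abs_gaussianReal 1 m v :
    Integrable (fun a : ℝ => Real.exp |a|) (gaussianReal m v)).mono'
    hc.aestronglyMeasurable (ae_of_all _ hb)

theorem exists_abs_le_of_isCompact {E : Set MixtureParam} (hE : IsCompact E) :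
    ∃ B, 0 ≤ B ∧ ∀ η ∈ E, ∀ y, |η.1 y| ≤ B ∧ |η.2 y| ≤ B := by
  obtain ⟨B, hB⟩ := hE.isBounded.exists_norm_le
  refine ⟨max B 0, le_max_right _ _, fun η hη y => ⟨?_, ?_⟩⟩
  · exact ((norm_le_pi_norm η.1 y).trans (norm_fst_le η)).trans ((hB η hη).trans (le_max_left _ _))
  · exact ((norm_le_pi_norm η.2 y).trans (norm_snd_le η)).trans ((hB η hη).trans (le_max_left _ _))

theorem continuousOn_plugInRisk {E : Set MixtureParam} (hE : IsCompact E)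
    (hEpos : ∀ η ∈ E, ∀ y, 0 < η.2 y) (w : ℤˣ → ℝ) {L : ℤˣ → ℝ → ℝ}
    (hc : ∀ y, Continuous (L y)) (hb : ∀ y a, |L y a| ≤ Real.exp |a|) :
    ContinuousOn (plugInRisk w L) E := by
  obtain ⟨B, -, hB⟩ := exists_abs_le_of_isCompact hE
  have heq : Set.EqOn (plugInRisk w L)
      (fun η => ∑ y, w y * ∫ u, L y (η.1 y + η.2 y * u) ∂gaussianReal 0 1) E := by
    intro η hη
    refine Finset.sum_congr rfl fun y _ => ?_
    rw [← integral_gaussianReal_eq_integral_mul (hEpos η hη y), gaussianReal_eq_map_affine,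
      integral_map (by fun_prop) (hc y).aestronglyMeasurable]
  refine ContinuousOn.congr ?_ heq
  refine continuousOn_finsetSum _ fun y _ => ContinuousOn.mul continuousOn_const ?_
  -- The bound comes from `|μ + σ u| ≤ B + B |u|`.
  refine continuousOn_of_dominated (bound := fun u => Real.exp B * Real.exp (B * |u|))
    (fun η _ => ((hc y).comp (by fun_prop)).aestronglyMeasurable)
    (fun η hη => ae_of_all _ fun u => ?_)
    ((integrable_exp_abs_gaussianReal B 0 1).const_mul _)
    (ae_of_all _ fun u => ((hc y).comp (by fun_prop)).continuousOn)
  refine (hb y _).trans ?_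
  rw [← Real.exp_add, Real.exp_le_exp]
  refine (abs_add_le _ _).trans (add_le_add (hB η hη y).1 ?_)
  rw [abs_mul]
  exact mul_le_mul_of_nonneg_right (hB η hη y).2 (abs_nonneg u)

theorem risk_eq_plugInRisk {d : ℕ} {p : Measure ((Fin d → ℝ) × ℤˣ)} [IsProbabilityMeasure p]
    {θ : Fin d → ℝ} {η : MixtureParam} (h : IsTrueParam p θ η) (hη : ∀ y, 0 < η.2 y)
    {L : ℤˣ → ℝ → ℝ} (hc : ∀ y, Continuous (L y)) (hb : ∀ y a, |L y a| ≤ Real.exp |a|) :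
    risk p L θ = plugInRisk (labelMarginal p) L η := by
  rw [risk, (integral_label_margin h fun y => integrable_of_abs_le_exp (hc y) (hb y) _ _).2]
  exact Finset.sum_congr rfl fun y _ => by rw [integral_gaussianReal_eq_integral_mul (hη y)]

/-! ### The mixture density -/

section Mixture

variable {w : ℤˣ → ℝ}

theorem mixtureDensity_pos (hw : ∀ y, 0 < w y) {η : MixtureParam} (hη : ∀ y, 0 < η.2 y) (z : ℝ) :
    0 < mixtureDensity w η z :=
  Finset.sum_pos (fun y _ => mul_pos (hw y)
    (gaussianPDFReal_pos _ _ _ (toNNReal_sq_ne_zero (hη y)))) Finset.univ_nonempty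

theorem continuousOn_mixtureDensity (w : ℤˣ → ℝ) :
    ContinuousOn (fun q : MixtureParam × ℝ => mixtureDensity w q.1 q.2)
      {q | ∀ y, 0 < q.1.2 y} := by
  simp only [mixtureDensity, gaussianPDFReal_sq]
  refine continuousOn_finsetSum _ fun y _ => continuousOn_const.mul (ContinuousOn.mul ?_ ?_)
  · refine ContinuousOn.inv₀ (by fun_prop) fun q hq => ?_
    have := hq y
    positivity
  · refine Real.continuous_exp.comp_continuousOn (ContinuousOn.div (by fun_prop) (by fun_prop) ?_)
    intro q hq
    have := hq y
    positivity

theorem continuous_mixtureDensity (w : ℤˣ → ℝ) {η : MixtureParam} (hη : ∀ y, 0 < η.2 y) :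
    Continuous (mixtureDensity w η) :=
  (continuousOn_mixtureDensity w).comp_continuous (f := fun z => (η, z)) (by fun_prop)
    fun _ => hη

theorem integrable_mixtureDensity_mul {η : MixtureParam} (hη : ∀ y, 0 < η.2 y) {f : ℝ → ℝ}
    (hf : ∀ y, Integrable f (gaussianReal (η.1 y) (Real.toNNReal (η.2 y ^ 2)))) :
    Integrable (fun z => mixtureDensity w η z * f z) ∧
      ∫ z, mixtureDensity w η z * f z
        = ∑ y, w y * ∫ z, f z ∂gaussianReal (η.1 y) (Real.toNNReal (η.2 y ^ 2)) := by
  have hint : ∀ y ∈ (Finset.univ : Finset ℤˣ), Integrable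
      (fun z => w y * (gaussianPDFReal (η.1 y) (Real.toNNReal (η.2 y ^ 2)) z * f z)) :=
    fun y _ => ((integrable_gaussianReal_iff (hη y) f).1 (hf y)).const_mul _
  have heq : (fun z => mixtureDensity w η z * f z) = fun z => ∑ y : ℤˣ,
      w y * (gaussianPDFReal (η.1 y) (Real.toNNReal (η.2 y ^ 2)) z * f z) := by
    ext z
    simp only [mixtureDensity, Finset.sum_mul, mul_assoc]
  rw [heq]
  refine ⟨integrable_finsetSum _ hint, ?_⟩
  rw [integral_finsetSum _ hint]
  exact Finset.sum_congr rfl fun y _ => by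
    rw [integral_const_mul, integral_gaussianReal_eq_integral_mul (hη y)]

/-- The log-density of a mixture grows at most quadratically, uniformly over a compact set. -/
theorem exists_abs_log_mixtureDensity_le (hw : ∀ y, 0 < w y) {E : Set MixtureParam}
    (hE : IsCompact E) (hEpos : ∀ η ∈ E, ∀ y, 0 < η.2 y) :
    ∃ C, 0 ≤ C ∧ ∀ η ∈ E, ∀ z, |Real.log (mixtureDensity w η z)| ≤ C * (1 + z ^ 2) := by
  obtain ⟨B, hB0, hB⟩ := exists_abs_le_of_isCompact hE
  obtain ⟨s, hs, hsE⟩ : ∃ s : ℝ, 0 < s ∧ ∀ η ∈ E, ∀ y, s ≤ η.2 y := by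
    rcases E.eq_empty_or_nonempty with rfl | hne
    · exact ⟨1, one_pos, by simp⟩
    have hc : ContinuousOn (fun η : MixtureParam => min (η.2 1) (η.2 (-1))) E := by fun_prop
    obtain ⟨ζ, hζ, hmin⟩ := hE.exists_isMinOn hne hc
    refine ⟨_, lt_min (hEpos ζ hζ 1) (hEpos ζ hζ (-1)), fun η hη y => ?_⟩
    refine (hmin hη).trans ?_
    rcases Int.units_eq_one_or y with rfl | rfl
    · exact min_le_left _ _
    · exact min_le_right _ _
  have hpi := Real.pi_pos
  set A : ℝ := (∑ y, w y) * (√(2 * Real.pi * s ^ 2))⁻¹ with hA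
  -- The lower bound keeps only the component with label `1`; the `+ 1` keeps the root positive when
  -- `B = 0`.
  set a : ℝ := w 1 * (√(2 * Real.pi * (B ^ 2 + 1)))⁻¹ with ha
  have hapos : 0 < a := by
    have := hw 1
    positivity
  set b : ℝ := (1 + B ^ 2) / s ^ 2 with hb
  have hbpos : 0 < b := by positivity
  refine ⟨|Real.log A| + |Real.log a| + b, by positivity, fun η hη z => ?_⟩
  have hpos := mixtureDensity_pos hw (hEpos η hη) z
  have hup : mixtureDensity w η z ≤ A := by
    rw [hA, mixtureDensity, Finset.sum_mul]
    refine Finset.sum_le_sum fun y _ => mul_le_mul_of_nonneg_left ?_ (hw y).le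
    rw [gaussianPDFReal_sq]
    have h1 : (√(2 * Real.pi * η.2 y ^ 2))⁻¹ ≤ (√(2 * Real.pi * s ^ 2))⁻¹ := by
      have := hsE η hη y
      gcongr
    have h2 : Real.exp (-(z - η.1 y) ^ 2 / (2 * η.2 y ^ 2)) ≤ 1 := by
      rw [Real.exp_le_one_iff, neg_div]
      have : 0 ≤ (z - η.1 y) ^ 2 / (2 * η.2 y ^ 2) := by positivity
      linarith
    calc _ ≤ (√(2 * Real.pi * s ^ 2))⁻¹ * 1 :=
          mul_le_mul h1 h2 (Real.exp_pos _).le (by positivity)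
      _ = _ := mul_one _
  have hlow : a * Real.exp (-(b * (1 + z ^ 2))) ≤ mixtureDensity w η z := by
    have h1 : w 1 * gaussianPDFReal (η.1 1) (Real.toNNReal (η.2 1 ^ 2)) z
        ≤ mixtureDensity w η z :=
      Finset.single_le_sum (f := fun y => w y *
        gaussianPDFReal (η.1 y) (Real.toNNReal (η.2 y ^ 2)) z)
        (fun y _ => mul_nonneg (hw y).le (gaussianPDFReal_nonneg _ _ _)) (Finset.mem_univ 1)
    refine le_trans ?_ h1
    rw [ha, mul_assoc, gaussianPDFReal_sq]
    have hσ := hEpos η hη 1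
    have hσB : η.2 1 ^ 2 ≤ B ^ 2 := sq_le_sq' (by linarith) ((abs_le.1 (hB η hη 1).2).2)
    have hμB : η.1 1 ^ 2 ≤ B ^ 2 := sq_le_sq.2 ((hB η hη 1).1.trans (le_abs_self B))
    refine mul_le_mul_of_nonneg_left (mul_le_mul ?_ ?_ (Real.exp_pos _).le (by positivity))
      (hw 1).le
    · gcongr
      linarith
    · rw [Real.exp_le_exp, neg_div, neg_le_neg_iff]
      have h3 : (z - η.1 1) ^ 2 ≤ 2 * ((1 + B ^ 2) * (1 + z ^ 2)) := by
        nlinarith [sq_nonneg (z + η.1 1), mul_nonneg (sq_nonneg B) (sq_nonneg z)]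
      calc (z - η.1 1) ^ 2 / (2 * η.2 1 ^ 2)
          ≤ 2 * ((1 + B ^ 2) * (1 + z ^ 2)) / (2 * s ^ 2) := by
            have := hsE η hη 1
            gcongr
        _ = b * (1 + z ^ 2) := by
            rw [hb]
            field_simp
  have hlogup := Real.log_le_log hpos hup
  have hloglow := Real.log_le_log (by positivity) hlow
  rw [Real.log_mul hapos.ne' (Real.exp_pos _).ne', Real.log_exp] at hloglow
  have hz := sq_nonneg z
  have e1 := le_abs_self (Real.log A)
  have e2 := neg_abs_le (Real.log a)
  have e3 := mul_nonneg (abs_nonneg (Real.log A)) hz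
  have e4 := mul_nonneg (abs_nonneg (Real.log a)) hz
  have e5 : 0 ≤ b * (1 + z ^ 2) := by positivity
  have e6 := abs_nonneg (Real.log A)
  have e7 := abs_nonneg (Real.log a)
  rw [abs_le]
  constructor <;> linarith

end Mixture

/-! ### Strict Gibbs inequality for mixtures -/

theorem integrable_log_mixtureDensity {w : ℤˣ → ℝ} (hw : ∀ y, 0 < w y) {η : MixtureParam}
    (hη : ∀ y, 0 < η.2 y) (m : ℝ) (v : NNReal) :
    Integrable (fun z => Real.log (mixtureDensity w η z)) (gaussianReal m v) := by
  obtain ⟨C, -, hC⟩ := exists_abs_log_mixtureDensity_le hw (isCompact_singleton (x := η))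
    (by rintro _ rfl; exact hη)
  refine (((integrable_const (1 : ℝ)).add (integrable_sq_gaussianReal m v)).const_mul C).mono'
    ?_ (ae_of_all _ fun z => hC η rfl z)
  exact ((continuous_mixtureDensity w hη).log
    fun z => (mixtureDensity_pos hw hη z).ne').aestronglyMeasurable

theorem sub_sub_mul_log_nonneg {a b : ℝ} (ha : 0 < a) (hb : 0 < b) :
    0 ≤ a - b - (b * Real.log a - b * Real.log b) := by
  have h := Real.log_le_sub_one_of_pos (div_pos ha hb)
  rw [Real.log_div ha.ne' hb.ne'] at h
  have h2 := mul_le_mul_of_nonneg_left h hb.le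
  rw [mul_sub, mul_sub, mul_div_cancel₀ _ hb.ne'] at h2
  linarith

theorem eq_of_sub_sub_mul_log_eq_zero {a b : ℝ} (ha : 0 < a) (hb : 0 < b)
    (h0 : a - b - (b * Real.log a - b * Real.log b) = 0) : a = b := by
  by_contra hab
  have h := Real.log_lt_sub_one_of_pos (div_pos ha hb)
    fun h => hab ((div_eq_one_iff_eq hb.ne').1 h)
  rw [Real.log_div ha.ne' hb.ne'] at h
  have h2 := mul_lt_mul_of_pos_left h hb
  rw [mul_sub, mul_sub, mul_div_cancel₀ _ hb.ne'] at h2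
  linarith

/-- With densities `a` of `η` and `b` of `ξ`, the function `a - b - b log (a / b)` is nonnegative,
and `a`, `b` have equal mass. Failure of the inequality would make its integral zero, hence `a = b`
almost everywhere, then everywhere by continuity, against identifiability. -/
theorem expected_log_mixtureDensity_lt {w : ℤˣ → ℝ} (hw : ∀ y, 0 < w y) (hne : w 1 ≠ w (-1))
    {η ξ : MixtureParam} (hη : ∀ y, 0 < η.2 y) (hξ : ∀ y, 0 < ξ.2 y) (h : η ≠ ξ) :
    ∑ y, w y * ∫ z, Real.log (mixtureDensity w η z)
        ∂gaussianReal (ξ.1 y) (Real.toNNReal (ξ.2 y ^ 2))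
      < ∑ y, w y * ∫ z, Real.log (mixtureDensity w ξ z)
        ∂gaussianReal (ξ.1 y) (Real.toNNReal (ξ.2 y ^ 2)) := by
  by_contra! hle
  obtain ⟨i1, e1⟩ := integrable_mixtureDensity_mul (w := w) hξ
    (fun y => integrable_log_mixtureDensity hw hη (ξ.1 y) (Real.toNNReal (ξ.2 y ^ 2)))
  obtain ⟨i2, e2⟩ := integrable_mixtureDensity_mul (w := w) hξ
    (fun y => integrable_log_mixtureDensity hw hξ (ξ.1 y) (Real.toNNReal (ξ.2 y ^ 2)))
  obtain ⟨i3, e3⟩ := integrable_mixtureDensity_mul (w := w) hη (f := fun _ => 1)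
    (fun y => integrable_const _)
  obtain ⟨i4, e4⟩ := integrable_mixtureDensity_mul (w := w) hξ (f := fun _ => 1)
    (fun y => integrable_const _)
  simp only [mul_one, integral_const, probReal_univ, smul_eq_mul] at i3 e3 i4 e4
  have hnn : 0 ≤ fun z => mixtureDensity w η z - mixtureDensity w ξ z -
      (mixtureDensity w ξ z * Real.log (mixtureDensity w η z) -
        mixtureDensity w ξ z * Real.log (mixtureDensity w ξ z)) := fun z =>
    sub_sub_mul_log_nonneg (mixtureDensity_pos hw hη z) (mixtureDensity_pos hw hξ z)
  have i5 := (i3.sub i4).sub (i1.sub i2)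
  have hint : ∫ z, (mixtureDensity w η z - mixtureDensity w ξ z -
      (mixtureDensity w ξ z * Real.log (mixtureDensity w η z) -
        mixtureDensity w ξ z * Real.log (mixtureDensity w ξ z))) = 0 := by
    refine le_antisymm ?_ (integral_nonneg hnn)
    have e5 := integral_sub' (i3.sub i4) (i1.sub i2)
    rw [integral_sub' i3 i4, integral_sub' i1 i2, e1, e2, e3, e4] at e5
    exact e5.trans_le (by linarith)
  have hae := (integral_eq_zero_iff_of_nonneg hnn i5).1 hint
  have cη := continuous_mixtureDensity w hη
  have cξ := continuous_mixtureDensity w hξ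
  have lη := cη.log fun z => (mixtureDensity_pos hw hη z).ne'
  have lξ := cξ.log fun z => (mixtureDensity_pos hw hξ z).ne'
  have hfun := (Continuous.ae_eq_iff_eq volume (by fun_prop) continuous_zero).1 hae
  refine h (mixtureDensity_injective hw hne hη hξ fun z => ?_)
  exact eq_of_sub_sub_mul_log_eq_zero (mixtureDensity_pos hw hη z) (mixtureDensity_pos hw hξ z)
    (congrFun hfun z)

/-! ### Closedness of the set of true parameters -/

/-- In terms of characteristic functions, the relation is a family of equations, one for each label
and frequency, between continuous functions of `(η, θ)`. -/
theorem isClosed_isTrueParam {d : ℕ} (p : Measure ((Fin d → ℝ) × ℤˣ)) [IsProbabilityMeasure p] :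
    IsClosed {q : MixtureParam × (Fin d → ℝ) | IsTrueParam p q.2 q.1} := by
  have hm : ∀ θ : Fin d → ℝ, Measurable fun z : (Fin d → ℝ) × ℤˣ => marginFun θ z.1 :=
    fun θ => (measurable_marginFun θ).comp measurable_fst
  have hset : {q : MixtureParam × (Fin d → ℝ) | IsTrueParam p q.2 q.1} = ⋂ (y : ℤˣ) (t : ℝ),
      {q | ∫ z, Complex.exp (t * marginFun q.2 z.1 * Complex.I)
          ∂ProbabilityTheory.cond p (Prod.snd ⁻¹' {y})
        = Complex.exp (t * (q.1.1 y : ℝ) * Complex.I - ((q.1.2 y ^ 2 : ℝ) : ℂ) * t ^ 2 / 2)} := by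
    ext q
    simp only [Set.mem_iInter, Set.mem_ofPred_eq]
    refine forall_congr' fun y => ?_
    have key : ∀ t : ℝ,
        charFun ((ProbabilityTheory.cond p (Prod.snd ⁻¹' {y})).map fun z => marginFun q.2 z.1) t
          = ∫ z, Complex.exp (t * marginFun q.2 z.1 * Complex.I)
            ∂ProbabilityTheory.cond p (Prod.snd ⁻¹' {y}) := fun t => by
      rw [charFun_apply_real, integral_map (hm _).aemeasurable (by fun_prop)]
    have key2 : ∀ t : ℝ, charFun (gaussianReal (q.1.1 y) (Real.toNNReal (q.1.2 y ^ 2))) t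
        = Complex.exp (t * (q.1.1 y : ℝ) * Complex.I
          - ((q.1.2 y ^ 2 : ℝ) : ℂ) * t ^ 2 / 2) := fun t => by
      rw [charFun_gaussianReal, Real.coe_toNNReal _ (sq_nonneg _)]
    simp_rw [← key, ← key2]
    exact ⟨fun h t => by rw [h], fun h => Measure.ext_of_charFun (funext h)⟩
  rw [hset]
  refine isClosed_iInter fun y => isClosed_iInter fun t => isClosed_eq ?_ ?_
  · refine continuous_of_dominated (bound := fun _ => 1) (fun q => ?_)
      (fun q => ae_of_all _ fun z => ?_) (integrable_const _) (ae_of_all _ fun z => ?_)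
    · have := hm q.2
      exact Measurable.aestronglyMeasurable (by fun_prop)
    · rw [← Complex.ofReal_mul, Complex.norm_exp_ofReal_mul_I]
    · have : Continuous fun q : MixtureParam × (Fin d → ℝ) => marginFun q.2 z.1 :=
        continuous_marginFun.comp (f := fun q : MixtureParam × (Fin d → ℝ) => (q.2, z.1))
          (by fun_prop)
      fun_prop
  · fun_prop

/-! ### An integrable envelope -/

/-- The directions in which a measure on `ℝ^d` has a finite second moment. -/
def squareIntegrableDirections {d : ℕ} (ν : Measure (Fin d → ℝ)) : Submodule ℝ (Fin d → ℝ) where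
  carrier := {θ | MemLp (marginFun θ) 2 ν}
  zero_mem' := by
    have h : marginFun (0 : Fin d → ℝ) = fun _ => 0 := by
      ext x
      simp [marginFun]
    simp [h]
  add_mem' {a b} ha hb := by
    have h : marginFun (a + b) = marginFun a + marginFun b := funext (marginFun_add a b)
    rw [Set.mem_ofPred_eq, h]
    exact ha.add hb
  smul_mem' c a ha := by
    have h : marginFun (c • a) = c • marginFun a := funext (marginFun_smul c a)
    rw [Set.mem_ofPred_eq, h]
    exact ha.const_smul c

/-- `ν` may lack second moments in some directions. Those with second moments form a subspace,
closed by finite dimension, hence containing `closure Θ`; in a basis of it the coordinates of `θ`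
are bounded. -/
theorem exists_integrable_sq_envelope {d : ℕ} {ν : Measure (Fin d → ℝ)} {Θ : Set (Fin d → ℝ)}
    (hΘ : Bornology.IsBounded Θ) (h : ∀ θ ∈ Θ, Integrable (fun x => marginFun θ x ^ 2) ν) :
    ∃ H, Integrable H ν ∧ ∀ θ ∈ closure Θ, ∀ x, marginFun θ x ^ 2 ≤ H x := by
  set V := squareIntegrableDirections ν
  have hsub : closure Θ ⊆ V := by
    refine closure_minimal (fun θ hθ => ?_) V.closed_of_finiteDimensional
    exact (memLp_two_iff_integrable_sq (measurable_marginFun θ).aestronglyMeasurable).2 (h θ hθ)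
  obtain ⟨R, hR⟩ := hΘ.closure.exists_norm_le
  set b := Module.finBasis ℝ V
  set C : ℝ := ‖b.equivFunL.toContinuousLinearMap‖ * R
  have hsum : MemLp (fun x => ∑ i, |marginFun (b i : Fin d → ℝ) x|) 2 ν :=
    memLp_finsetSum _ fun i _ => (show MemLp (marginFun (b i)) 2 ν from (b i).2).abs
  refine ⟨fun x => C ^ 2 * (∑ i, |marginFun (b i : Fin d → ℝ) x|) ^ 2,
    hsum.integrable_sq.const_mul _, fun θ hθ x => ?_⟩
  beta_reduce
  rw [← mul_pow, ← sq_abs]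
  refine pow_le_pow_left₀ (abs_nonneg _) ?_ 2
  have hrep : θ = ∑ i, b.equivFunL ⟨θ, hsub hθ⟩ i • (b i : Fin d → ℝ) := by
    have := congrArg V.subtype (b.sum_equivFun ⟨θ, hsub hθ⟩)
    rw [map_sum] at this
    exact this.symm
  have hmar : marginFun θ x = ∑ i, b.equivFunL ⟨θ, hsub hθ⟩ i * marginFun (b i) x := by
    conv_lhs => rw [hrep]
    simp only [marginFun, Finset.sum_apply, Pi.smul_apply, smul_eq_mul, Finset.sum_mul,
      Finset.mul_sum, mul_assoc]
    exact Finset.sum_comm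
  rw [hmar, Finset.mul_sum]
  refine (Finset.abs_sum_le_sum_abs _ _).trans (Finset.sum_le_sum fun i _ => ?_)
  rw [abs_mul]
  refine mul_le_mul_of_nonneg_right ?_ (abs_nonneg _)
  refine (norm_le_pi_norm (b.equivFunL ⟨θ, hsub hθ⟩) i).trans ?_
  refine (b.equivFunL.toContinuousLinearMap.le_opNorm ⟨θ, hsub hθ⟩).trans ?_
  exact mul_le_mul_of_nonneg_left (hR θ hθ) (norm_nonneg _)

/-! ### Uniform strong law of large numbers over a compact index space -/

/-- This is the strong law for the `C(K, ℝ)`-valued variables `G (X i)`; convergence in sup norm is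
uniformity in `k`. Second countability of `S` makes `G` strongly measurable, whether or not `C(K,
ℝ)` is separable. -/
theorem uniform_strong_law {K S Ω : Type*} [TopologicalSpace K] [CompactSpace K]
    [TopologicalSpace S] [SecondCountableTopology S] [MeasurableSpace S] [BorelSpace S]
    [MeasurableSpace Ω] {P : Measure Ω} {ν : Measure S} {X : ℕ → Ω → S}
    (hXmeas : ∀ i, Measurable (X i)) (hXindep : iIndepFun X P) (hXlaw : ∀ i, P.map (X i) = ν)
    (G : C(S, C(K, ℝ))) {H : S → ℝ} (hH : Integrable H ν) (hGH : ∀ x, ‖G x‖ ≤ H x) :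
    ∃ l : C(K, ℝ), (∀ k, l k = ∫ x, G x k ∂ν) ∧ ∀ᵐ ω ∂P, ∀ ε > 0, ∀ᶠ n : ℕ in atTop, ∀ k,
      |(n : ℝ)⁻¹ * ∑ i ∈ Finset.range n, G (X i ω) k - l k| ≤ ε := by
  let _ : MeasurableSpace C(K, ℝ) := borel _
  have : BorelSpace C(K, ℝ) := ⟨rfl⟩
  have hGm : StronglyMeasurable G := G.continuous.stronglyMeasurable
  have hGint : Integrable G ν := hH.mono' hGm.aestronglyMeasurable (ae_of_all _ hGH)
  have hGXint : Integrable (fun ω => G (X 0 ω)) P :=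
    Integrable.comp_measurable (by rwa [hXlaw 0]) (hXmeas 0)
  refine ⟨∫ x, G x ∂ν, ContinuousMap.integral_apply hGint, ?_⟩
  have hslln := strong_law_ae (fun i ω => G (X i ω)) hGXint
    (fun i j hij => (hXindep.indepFun hij).comp G.continuous.measurable G.continuous.measurable)
    (fun i => IdentDistrib.comp (u := G) ⟨(hXmeas i).aemeasurable, (hXmeas 0).aemeasurable,
      by rw [hXlaw, hXlaw]⟩ G.continuous.measurable)
  have hmean : ∫ ω, G (X 0 ω) ∂P = ∫ x, G x ∂ν := by
    rw [← hXlaw 0, integral_map (hXmeas 0).aemeasurable hGm.aestronglyMeasurable]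
  rw [hmean] at hslln
  filter_upwards [hslln] with ω hω ε hε
  filter_upwards [Metric.tendsto_nhds.1 hω ε hε] with n hn k
  have := (ContinuousMap.dist_apply_le_dist k).trans hn.le
  simpa [Real.dist_eq, ContinuousMap.sum_apply] using this

/-! ### Consistency of the maximum likelihood estimates and of the plug-in risk -/

/-- A nearly maximal expected log-likelihood forces a nearly correct value of a continuous
functional of the parameter, uniformly over a compact set. -/
theorem exists_uniform_gap {A B : Type*} [TopologicalSpace A] [TopologicalSpace B]
    {E : Set A} {T : Set B} (hE : IsCompact E) (hT : IsCompact T) {D : Set (A × B)}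
    (hD : IsClosed D) {l : A × B → ℝ} (hl : ContinuousOn l (E ×ˢ T)) {r : A → ℝ}
    (hr : ContinuousOn r E)
    (hmax : ∀ ξ ∈ E, ∀ θ ∈ T, (ξ, θ) ∈ D → ∀ η ∈ E, η ≠ ξ → l (η, θ) < l (ξ, θ))
    {ε : ℝ} (hε : 0 < ε) :
    ∃ δ > 0, ∀ ξ ∈ E, ∀ θ ∈ T, (ξ, θ) ∈ D → ∀ η ∈ E, l (ξ, θ) - l (η, θ) < δ →
      |r η - r ξ| < ε := by
  have hK : IsCompact (E ×ˢ E ×ˢ T) := hE.prod (hE.prod hT)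
  have hrc : ContinuousOn (fun q : A × A × B => |r q.1 - r q.2.1|) (E ×ˢ E ×ˢ T) := by
    refine ContinuousOn.abs (ContinuousOn.sub ?_ ?_)
    · exact hr.comp (by fun_prop) fun q hq => hq.1
    · exact hr.comp (by fun_prop) fun q hq => hq.2.1
  have hlc : ContinuousOn (fun q : A × A × B => l q.2 - l (q.1, q.2.2)) (E ×ˢ E ×ˢ T) := by
    refine ContinuousOn.sub ?_ ?_
    · exact hl.comp (by fun_prop) fun q hq => hq.2
    · exact hl.comp (by fun_prop) fun q hq => ⟨hq.1, hq.2.2⟩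
  obtain ⟨F, hF, hFeq⟩ := (continuousOn_iff_isClosed.1 hrc) (Set.Ici ε) isClosed_Ici
  -- The compact set of bad triples `(η, ξ, θ)`: `ξ` is true for `θ`, yet `r` differs by at least
  -- `ε`.
  set S : Set (A × A × B) := (F ∩ (E ×ˢ E ×ˢ T)) ∩ Prod.snd ⁻¹' D with hS
  have hScomp : IsCompact S := (hK.inter_left hF).inter_right (hD.preimage continuous_snd)
  have hmem : ∀ η ∈ E, ∀ ξ ∈ E, ∀ θ ∈ T, (ξ, θ) ∈ D → ε ≤ |r η - r ξ| → (η, ξ, θ) ∈ S := by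
    intro η hη ξ hξ θ hθ hd hle
    refine ⟨?_, hd⟩
    rw [← hFeq]
    exact ⟨hle, hη, hξ, hθ⟩
  rcases S.eq_empty_or_nonempty with hempty | hne
  · refine ⟨1, one_pos, fun ξ hξ θ hθ hd η hη _ => ?_⟩
    by_contra! hle
    have := hmem η hη ξ hξ θ hθ hd hle
    rw [hempty] at this
    exact this
  obtain ⟨q, hq, hqmin⟩ := hScomp.exists_isMinOn hne (hlc.mono fun q hq => hq.1.2)
  -- `δ` is the smallest gap over bad triples, positive since `η ≠ ξ` on them.
  refine ⟨l q.2 - l (q.1, q.2.2), ?_, fun ξ hξ θ hθ hd η hη hlt => ?_⟩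
  · obtain ⟨hqF, hqD⟩ := hq
    have hqK := hqF.2
    rw [← hFeq] at hqF
    refine sub_pos.2 (hmax q.2.1 hqK.2.1 q.2.2 hqK.2.2 hqD q.1 hqK.1 fun heq => ?_)
    have : ε ≤ |r q.1 - r q.2.1| := hqF.1
    rw [heq, sub_self, abs_zero] at this
    exact absurd this (not_le.2 hε)
  · by_contra! hle
    exact absurd (hqmin (hmem η hη ξ hξ θ hθ hd hle)) (not_le.2 hlt)

/-- The log-likelihood of one observation, as a continuous function of the observation with values
in the continuous functions of the parameter and the classifier. -/
theorem exists_continuous_logDensity {d : ℕ} {w : ℤˣ → ℝ} (hw : ∀ y, 0 < w y)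
    {E : Set MixtureParam} (hEpos : ∀ η ∈ E, ∀ y, 0 < η.2 y) (T : Set (Fin d → ℝ)) :
    ∃ G : C(Fin d → ℝ, C(↥(E ×ˢ T), ℝ)), ∀ x k,
      G x k = Real.log (mixtureDensity w k.1.1 (marginFun k.1.2 x)) := by
  have hc : Continuous fun q : (Fin d → ℝ) × ↥(E ×ˢ T) =>
      Real.log (mixtureDensity w q.2.1.1 (marginFun q.2.1.2 q.1)) := by
    refine Continuous.log ?_ fun q => (mixtureDensity_pos hw (hEpos _ q.2.2.1) _).ne'
    have hm : Continuous fun q : (Fin d → ℝ) × ↥(E ×ˢ T) => marginFun q.2.1.2 q.1 :=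
      continuous_marginFun.comp (f := fun q : (Fin d → ℝ) × ↥(E ×ˢ T) => (q.2.1.2, q.1))
        (by fun_prop)
    exact (continuousOn_mixtureDensity w).comp_continuous
      (f := fun q : (Fin d → ℝ) × ↥(E ×ˢ T) => (q.2.1.1, marginFun q.2.1.2 q.1))
      (by fun_prop) fun q => hEpos _ q.2.2.1
  exact ⟨ContinuousMap.curry ⟨_, hc⟩, fun x k => rfl⟩

theorem tendstoUniformlyOn_plugInRisk {d : ℕ} (p : Measure ((Fin d → ℝ) × ℤˣ))
    [IsProbabilityMeasure p] (hp : labelMarginal p 1 ≠ labelMarginal p (-1))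
    {L : ℤˣ → ℝ → ℝ} (hLc : ∀ y, Continuous (L y)) (hLb : ∀ y a, |L y a| ≤ Real.exp |a|)
    {E : Set MixtureParam} (hE : IsCompact E) (hEpos : ∀ η ∈ E, ∀ y, 0 < η.2 y)
    {Θ : Set (Fin d → ℝ)} (hΘ : Bornology.IsBounded Θ)
    (hnormal : ∀ θ ∈ Θ, ∃ η ∈ E, IsTrueParam p θ η) (hw : ∀ y, 0 < labelMarginal p y)
    {Ω : Type*} [MeasurableSpace Ω] {P : Measure Ω}
    {X : ℕ → Ω → (Fin d → ℝ)} (hXmeas : ∀ i, Measurable (X i))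
    (hXindep : iIndepFun X P) (hXlaw : ∀ i, P.map (X i) = p.map Prod.fst)
    {etaHat : ℕ → (Fin d → ℝ) → Ω → MixtureParam}
    (hMLE : ∀ᵐ ω ∂P, ∀ n, ∀ θ ∈ Θ,
      IsMLE (labelMarginal p) E n (fun i => marginFun θ (X i ω)) (etaHat n θ ω)) :
    ∀ᵐ ω ∂P, TendstoUniformlyOn
      (fun n θ => plugInRisk (labelMarginal p) L (etaHat n θ ω)) (risk p L) atTop Θ := by
  set w := labelMarginal p
  have hT : IsCompact (closure Θ) := hΘ.isCompact_closure
  have hcompact : CompactSpace ↥(E ×ˢ closure Θ) := isCompact_iff_compactSpace.1 (hE.prod hT)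
  obtain ⟨C, hC0, hC⟩ := exists_abs_log_mixtureDensity_le hw hE hEpos
  obtain ⟨H, hH, hHb⟩ := exists_integrable_sq_envelope (ν := p.map Prod.fst) hΘ (by
    intro θ hθ
    obtain ⟨η, -, hη⟩ := hnormal θ hθ
    have h := (integral_label_margin hη (F := fun _ a => a ^ 2)
      fun y => integrable_sq_gaussianReal _ _).1
    exact (integrable_map_measure
      ((measurable_marginFun θ).pow_const 2).aestronglyMeasurable measurable_fst.aemeasurable).2 h)
  obtain ⟨G, hG⟩ := exists_continuous_logDensity hw hEpos (closure Θ)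
  have hprob : IsProbabilityMeasure (p.map (Prod.fst : (Fin d → ℝ) × ℤˣ → (Fin d → ℝ))) :=
    Measure.isProbabilityMeasure_map measurable_fst.aemeasurable
  -- The absolute value makes the envelope nonnegative without any sign information on `H`.
  have hnonneg : ∀ x, 0 ≤ C * (1 + |H x|) := fun x => by positivity
  obtain ⟨l, hl, hlim⟩ := uniform_strong_law hXmeas hXindep hXlaw G
    (H := fun x => C * (1 + |H x|)) (((integrable_const 1).add hH.abs).const_mul C) (fun x => by
      refine (ContinuousMap.norm_le _ (hnonneg x)).2 fun k => ?_
      rw [hG, Real.norm_eq_abs]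
      refine (hC _ k.2.1 _).trans (mul_le_mul_of_nonneg_left ?_ hC0)
      have := (hHb _ k.2.2 x).trans (le_abs_self (H x))
      linarith)
  set ll : MixtureParam × (Fin d → ℝ) → ℝ := fun q =>
    ∫ x, Real.log (mixtureDensity w q.1 (marginFun q.2 x)) ∂p.map Prod.fst with hll
  have hlll : ∀ q (hq : q ∈ E ×ˢ closure Θ), l ⟨q, hq⟩ = ll q := fun q hq => by
    rw [hl, hll]
    exact integral_congr_ae (ae_of_all _ fun x => hG x _)
  have hllc : ContinuousOn ll (E ×ˢ closure Θ) := by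
    rw [continuousOn_iff_continuous_domRestrict]
    exact l.continuous.congr fun k => hlll k.1 k.2
  have hllmix : ∀ ξ θ, IsTrueParam p θ ξ → ∀ η ∈ E, ll (η, θ) = ∑ y, w y *
      ∫ z, Real.log (mixtureDensity w η z)
        ∂gaussianReal (ξ.1 y) (Real.toNNReal (ξ.2 y ^ 2)) := by
    intro ξ θ hξ η hη
    rw [← (integral_label_margin hξ (F := fun _ z => Real.log (mixtureDensity w η z))
      fun y => integrable_log_mixtureDensity hw (hEpos η hη) _ _).2, hll]
    refine integral_map measurable_fst.aemeasurable (Measurable.aestronglyMeasurable ?_)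
    exact Real.measurable_log.comp
      ((continuous_mixtureDensity w (hEpos η hη)).measurable.comp (measurable_marginFun θ))
  filter_upwards [hlim, hMLE] with ω hω hmle
  rw [Metric.tendstoUniformlyOn_iff]
  intro ε hε
  obtain ⟨δ, hδ, hgap⟩ := exists_uniform_gap hE hT (isClosed_isTrueParam p) hllc
    (continuousOn_plugInRisk hE hEpos w hLc hLb) (by
      intro ξ hξ θ _ htrue η hη hne
      rw [hllmix ξ θ htrue η hη, hllmix ξ θ htrue ξ hξ]
      exact expected_log_mixtureDensity_lt hw hp (hEpos η hη) (hEpos ξ hξ) hne) hε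
  -- The approximation errors at the estimate and at the true parameter add up to at most `2δ / 3 <
  -- δ`.
  filter_upwards [hω (δ / 3) (by positivity)] with n hn θ hθ
  obtain ⟨ξ, hξ, htrue⟩ := hnormal θ hθ
  obtain ⟨hηE, hηmax⟩ := hmle n θ hθ
  have hθ' : θ ∈ closure Θ := subset_closure hθ
  rw [risk_eq_plugInRisk htrue (hEpos ξ hξ) hLc hLb, dist_comm, Real.dist_eq]
  refine hgap ξ hξ θ hθ' htrue _ hηE ?_
  have h1 := abs_le.1 (hn ⟨(etaHat n θ ω, θ), hηE, hθ'⟩)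
  have h2 := abs_le.1 (hn ⟨(ξ, θ), hξ, hθ'⟩)
  rw [hlll _ ⟨hηE, hθ'⟩] at h1
  rw [hlll _ ⟨hξ, hθ'⟩] at h2
  simp only [hG] at h1 h2
  have h3 := mul_le_mul_of_nonneg_left (hηmax hξ) (inv_nonneg.2 (Nat.cast_nonneg (α := ℝ) n))
  simp only [logLikelihood] at h3
  linarith

theorem mainTheorem6 {d : ℕ}
    -- the joint law of `(X, Y)`, with unequal label marginals
    (p : Measure ((Fin d → ℝ) × ℤˣ)) [IsProbabilityMeasure p]
    (hp : labelMarginal p 1 ≠ labelMarginal p (-1))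
    -- one of the three losses
    (L : ℤˣ → ℝ → ℝ) (hL : L = expLoss ∨ L = logLoss ∨ L = hingeLoss)
    -- the compact set of mixture parameters and the bounded set of classifiers
    (E : Set MixtureParam) (hE : IsCompact E) (hEpos : ∀ η ∈ E, ∀ y, 0 < η.2 y)
    (Θ : Set (Fin d → ℝ)) (hΘ : Bornology.IsBounded Θ)
    (hnormal : ∀ θ ∈ Θ, ∃ η ∈ E, IsTrueParam p θ η)
    -- the unlabeled i.i.d. sample
    {Ω : Type*} [MeasurableSpace Ω] (P : Measure Ω) [IsProbabilityMeasure P]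
    (X : ℕ → Ω → (Fin d → ℝ)) (hXmeas : ∀ i, Measurable (X i))
    (hXindep : iIndepFun X P) (hXlaw : ∀ i, P.map (X i) = p.map Prod.fst)
    -- the maximum likelihood estimates
    (etaHat : ℕ → (Fin d → ℝ) → Ω → MixtureParam)
    (hMLE : ∀ᵐ ω ∂P, ∀ n, ∀ θ ∈ Θ,
      IsMLE (labelMarginal p) E n (fun i => marginFun θ (X i ω)) (etaHat n θ ω)) :
    (∀ θ ∈ Θ, Integrable (fun z => L z.2 (marginFun θ z.1)) p) ∧
    (∀ η ∈ E, ∀ y, Integrable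
      (fun α => gaussianPDFReal (η.1 y) (Real.toNNReal (η.2 y ^ 2)) α * L y α)) ∧
    ∀ᵐ ω ∂P, TendstoUniformlyOn
      (fun n θ => plugInRisk (labelMarginal p) L (etaHat n θ ω)) (risk p L) atTop Θ := by
  have hLc := margin_loss_continuous hL
  have hLb := margin_loss_abs_le hL
  refine ⟨fun θ hθ => ?_, fun η hη y => ?_, ?_⟩
  · obtain ⟨η, -, hη⟩ := hnormal θ hθ
    exact (integral_label_margin hη fun y => integrable_of_abs_le_exp (hLc y) (hLb y) _ _).1
  · exact (integrable_gaussianReal_iff (hEpos η hη y) _).1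
      (integrable_of_abs_le_exp (hLc y) (hLb y) _ _)
  -- Positivity of the label marginals is available only from some `θ ∈ Θ`.
  · rcases Θ.eq_empty_or_nonempty with rfl | ⟨θ, hθ⟩
    · exact ae_of_all _ fun ω => tendstoUniformlyOn_empty
    · obtain ⟨η, -, hη⟩ := hnormal θ hθ
      exact tendstoUniformlyOn_plugInRisk p hp hLc hLb hE hEpos hΘ hnormal (labelMarginal_pos hη)
        hXmeas hXindep hXlaw hMLE
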